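/- Let $K$ be a field, let $S=K[x_1,\ldots,x_n]$, and let $I\subset S$ be a monomial ideal with minimal set of monomial generators $G(I)$. Put $\mathbf c=(c_1,\ldots,c_n)$ with $c_i=\max\{\deg_{x_i}u : u\in G(I)\}$ (and $\mathbf c=0$ if $I=0$). Let $S^\wp$ be the polynomial ring over $K$ in the variables $x_{ij}$, $1\le i\le n$, $1\le j\le c_i$, and let $\mathbf x=x_1,\ldots,x_n$ and $\mathbf x^\wp=x_{11},\ldots,x_{1c_1},x_{21},\ldots,x_{nc_n}$. For a monomial $u=x_1^{a_1}\cdots x_n^{a_n}$ with $a_i\le c_i$ for all $i$ put $u^\wp=\prod_{i=1}^n\prod_{j=1}^{a_i}x_{ij}$, and let $I^\wp\subset S^\wp$ be the ideal generated by the $u^\wp$ with $u\in G(I)$. Let $K(\mathbf x;I)=\bigwedge(\bigoplus_j Se_j)\otimes I$ with $\partial e_j=x_j$ be the Koszul complex of $\mathbf x$ with values in $I$, and let $K(\mathbf x^\wp;I^\wp)$ be the Koszul complex of $\mathbf x^\wp$ with values in $I^\wp$, with basis elements $e_{ij}$ satisfying $\partial e_{ij}=x_{ij}$. Denote their homology by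 $H_i(\mathbf x;I)$ and $H_i(\mathbf x^\wp;I^\wp)$. For $J=\{j_1<\cdots<j_i\}$ put $e_J=e_{j_1}\wedge\cdots\wedge e_{j_i}$. The multidegree of $u\,e_J$, where $u=x_1^{a_1}\cdots x_n^{a_n}$ is a monomial, is the vector whose $k$-th entry is $a_k+1$ if $k\in J$ and $a_k$ otherwise. If it is componentwise $\le\mathbf c$, put $$(u\,e_J)^\wp=u^\wp\, e_{j_1,a_{j_1}+1}\wedge\cdots\wedge e_{j_i,a_{j_i}+1}.$$ For a multihomogeneous element $f=\sum_J\lambda_J u_J e_J$ ($\lambda_J\in K$) of multidegree $\le\mathbf c$ put $f^\wp=\sum_J\lambda_J(u_Je_J)^\wp$. **Theorem.** Let $i\ge 0$, and let $z_1,\ldots,z_r\in K_i(\mathbf x;I)$ be multihomogeneous cycles, each of multidegree $\le\mathbf c$ componentwise, whose homology classes form a $K$-basis of $H_i(\mathbf x;I)$. Then $z_1^\wp,\ldots,z_r^\wp$ are cycles of $K_i(\mathbf x^\wp;I^\wp)$, and their homology classes form a $K$-basis of $H_i(\mathbf x^\wp;I^\wp)$. -/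

import Mathlib

open MvPolynomial

noncomputable section

namespace KoszulPol

section Koszul

variable {ι R : Type*} [LinearOrder ι]

/-- The sign `(-1)^{#{k ∈ J : k < j}}`, so that `e_j ∧ e_J` equals this sign times `e_{J ∪ {j}}`
for `j ∉ J`, where `e_J = e_{j₁} ∧ ⋯ ∧ e_{jₚ}` for `J = {j₁ < ⋯ < jₚ}`. -/
def koszulSign (j : ι) (J : Finset ι) : ℤ := (-1) ^ (J.filter (fun k => k < j)).card

lemma koszulSign_swap {j k : ι} {J : Finset ι} (hj : j ∉ J) (h : j < k) :
    koszulSign j J * koszulSign k (insert j J) = -(koszulSign k J * koszulSign j (insert k J)) := by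
  have h1 : (insert j J).filter (fun l => l < k) = insert j (J.filter (fun l => l < k)) := by
    rw [Finset.filter_insert, if_pos h]
  have h2 : (insert k J).filter (fun l => l < j) = J.filter (fun l => l < j) := by
    rw [Finset.filter_insert, if_neg (not_lt.mpr h.le)]
  unfold koszulSign
  rw [h1, h2, Finset.card_insert_of_notMem (by simp [hj])]
  ring

variable [Fintype ι] [CommRing R]

/-- The differential of the Koszul complex `K(x) = ⋀ (⨁ⱼ R eⱼ)` of the family `x`. An element
`∑_J f_J e_J` of the exterior algebra is given by its coefficients `J ↦ f_J`. The formula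
is `∂ (e_{j₁} ∧ ⋯ ∧ e_{jₚ}) = ∑ₖ (-1)^{k+1} x_{jₖ} e_{J \ {jₖ}}`, read off at the coefficient
of each `e_J`. -/
def koszulD (x : ι → R) : (Finset ι → R) →ₗ[R] (Finset ι → R) where
  toFun f J := ∑ j ∈ Jᶜ, koszulSign j J • (x j * f (insert j J))
  map_add' f g := by
    funext J
    simp [mul_add, Finset.sum_add_distrib]
  map_smul' r f := by
    funext J
    simp only [Pi.smul_apply, smul_eq_mul, RingHom.id_apply, Finset.mul_sum]
    refine Finset.sum_congr rfl fun j _ => ?_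
    rw [mul_smul_comm, mul_left_comm]

/-- The module `K_i(x; I) = ⋀ⁱ (⨁ⱼ R eⱼ) ⊗ I`: the elements `∑_J f_J e_J`, the sum over the `J`
with `i` elements, with all `f_J ∈ I`. -/
def koszulChains (I : Ideal R) (i : ℕ) : Submodule R (Finset ι → R) where
  carrier := {f | (∀ J, f J ∈ I) ∧ ∀ J, J.card ≠ i → f J = 0}
  add_mem' := by
    rintro f g ⟨hf, hf'⟩ ⟨hg, hg'⟩
    exact ⟨fun J => I.add_mem (hf J) (hg J), fun J hJ => by simp [hf' J hJ, hg' J hJ]⟩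
  zero_mem' := ⟨fun _ => I.zero_mem, fun _ _ => rfl⟩
  smul_mem' := by
    rintro r f ⟨hf, hf'⟩
    exact ⟨fun J => I.mul_mem_left r (hf J), fun J hJ => by simp [hf' J hJ]⟩

/-- The cycles `Z_i(x; I)`. (On `K_0` the differential is zero.) -/
def koszulCycles (x : ι → R) (I : Ideal R) (i : ℕ) : Submodule R (Finset ι → R) :=
  koszulChains I i ⊓ LinearMap.ker (koszulD x)

/-- The boundaries `B_i(x; I) = ∂ (K_{i+1}(x; I))`. -/
def koszulBoundaries (x : ι → R) (I : Ideal R) (i : ℕ) : Submodule R (Finset ι → R) :=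
  (koszulChains I (i + 1)).map (koszulD x)

lemma koszulD_koszulD (x : ι → R) (f : Finset ι → R) : koszulD x (koszulD x f) = 0 := by
  funext J
  change ∑ j ∈ Jᶜ, koszulSign j J • (x j * ∑ k ∈ (insert j J)ᶜ,
    koszulSign k (insert j J) • (x k * f (insert k (insert j J)))) = 0
  simp only [Finset.mul_sum, Finset.smul_sum]
  rw [Finset.sum_sigma']
  refine Finset.sum_involution (fun p _ => ⟨p.2, p.1⟩) ?_ ?_ ?_ ?_
  · rintro ⟨j, k⟩ hp
    simp only [Finset.mem_sigma, Finset.mem_compl, Finset.mem_insert, not_or] at hp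
    obtain ⟨hj, hkj, hk⟩ := hp
    have key : koszulSign j J * koszulSign k (insert j J) =
        -(koszulSign k J * koszulSign j (insert k J)) := by
      rcases lt_or_gt_of_ne hkj with h | h
      · rw [koszulSign_swap hk h, neg_neg]
      · exact koszulSign_swap hj h
    have key' := congrArg (Int.cast : ℤ → R) key
    push_cast at key'
    simp only [zsmul_eq_mul, Finset.insert_comm j k J]
    linear_combination (x j * x k * f (insert k (insert j J))) * key'
  · rintro ⟨j, k⟩ hp _ h
    simp only [Finset.mem_sigma, Finset.mem_compl, Finset.mem_insert, not_or] at hp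
    exact hp.2.1 (congrArg Sigma.fst h)
  · rintro ⟨j, k⟩ hp
    simp only [Finset.mem_sigma, Finset.mem_compl, Finset.mem_insert, not_or] at hp ⊢
    exact ⟨hp.2.2, fun h => hp.2.1 h.symm, hp.1⟩
  · intros; rfl

lemma koszulBoundaries_le_koszulCycles (x : ι → R) (I : Ideal R) (i : ℕ) :
    koszulBoundaries x I i ≤ koszulCycles x I i := by
  rintro _ ⟨f, ⟨hf, hf'⟩, rfl⟩
  refine ⟨⟨fun J => ?_, fun J hJ => ?_⟩, koszulD_koszulD x f⟩
  · exact I.sum_mem fun j _ => zsmul_mem (I.mul_mem_left _ (hf _)) _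
  · refine Finset.sum_eq_zero fun j hj => ?_
    rw [hf' _ (by rw [Finset.card_insert_of_notMem (by simpa using hj)]; omega)]
    simp

/-- The Koszul homology `H_i(x; I) = Z_i(x; I) / B_i(x; I)`. -/
abbrev KoszulHomology (x : ι → R) (I : Ideal R) (i : ℕ) : Type _ :=
  koszulCycles x I i ⧸ (koszulBoundaries x I i).submoduleOf (koszulCycles x I i)

/-- The homology class of a cycle. -/
def homologyClass (x : ι → R) (I : Ideal R) (i : ℕ) (z : koszulCycles x I i) :
    KoszulHomology x I i :=
  Submodule.Quotient.mk z

end Koszul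

section Polarization

variable {K : Type*} [Field K] {n : ℕ}

/-- A monomial ideal: an ideal generated by a set of monomials (given by their exponents). -/
def IsMonomialIdeal (I : Ideal (MvPolynomial (Fin n) K)) : Prop :=
  ∃ A : Set (Fin n →₀ ℕ), I = Ideal.span ((fun a => monomial a (1 : K)) '' A)

/-- The exponents of the elements of `G(I)`, the minimal monomial generators of a monomial
ideal `I`: the monomials in `I` that are minimal with respect to divisibility. -/
def minGens (I : Ideal (MvPolynomial (Fin n) K)) : Set (Fin n →₀ ℕ) :=
  {a | Minimal (fun b => monomial b (1 : K) ∈ I) a}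

lemma minGens_finite (I : Ideal (MvPolynomial (Fin n) K)) : (minGens I).Finite := by
  have h1 : IsAntichain (· ≤ ·) (minGens I) := setOfPred_minimal_antichain _
  exact WellQuasiOrderedLE.finite_of_isAntichain h1

/-- `c_i = max {deg_{x_i} u : u ∈ G(I)}` (and `c_i = 0` for `I = 0`). -/
def maxExponent (I : Ideal (MvPolynomial (Fin n) K)) (i : Fin n) : ℕ :=
  (minGens_finite I).toFinset.sup (fun a => a i)

/-- The index set of the variables `x_{ij}`, `1 ≤ i ≤ n`, `1 ≤ j ≤ c_i`, ordered
lexicographically: `x_{11}, …, x_{1c_1}, x_{21}, …, x_{nc_n}`. The second index starts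
from `0` in the code: `x_{i,j+1}` belongs to `⟨i, j⟩` with `j : Fin (c i)`. -/
abbrev PolVar (c : Fin n → ℕ) : Type := Σₗ i : Fin n, Fin (c i)

/-- The polarization `∏ᵢ ∏_{1 ≤ j ≤ aᵢ} x_{ij}` of the monomial with exponent `a ≤ c`. -/
def polMonomial (K : Type*) [Field K] (c : Fin n → ℕ) (a : Fin n →₀ ℕ) :
    MvPolynomial (PolVar c) K :=
  ∏ i : Fin n, ∏ j ∈ Finset.univ.filter (fun j : Fin (c i) => (j : ℕ) < a i), X (toLex ⟨i, j⟩)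

/-- The polarization `I^℘` of a monomial ideal `I`, generated by the `u^℘` with `u ∈ G(I)`. -/
def polIdeal (c : Fin n → ℕ) (I : Ideal (MvPolynomial (Fin n) K)) :
    Ideal (MvPolynomial (PolVar c) K) :=
  Ideal.span (polMonomial K c '' minGens I)

/-- The set of the indices `(j, a_j + 1)`, `j ∈ J` (counted from `1`), in the polarization
`u^℘ e_{j₁, a_{j₁}+1} ∧ ⋯ ∧ e_{jₚ, a_{jₚ}+1}` of `u e_J`, where `u` has exponent `a` and
`u e_J` has multidegree at most `c`. -/
def polIndex (c : Fin n → ℕ) (a : Fin n →₀ ℕ) (J : Finset (Fin n)) : Finset (PolVar c) :=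
  Finset.univ.filter fun v => (ofLex v).1 ∈ J ∧ ((ofLex v).2 : ℕ) = a (ofLex v).1

/-- The polarization `f^℘ = ∑ λ (u e_J)^℘` of an element `f = ∑ λ u e_J` of the Koszul complex
(meaningful if all its terms `u e_J` have multidegree at most `c`). -/
def polChain (c : Fin n → ℕ) (f : Finset (Fin n) → MvPolynomial (Fin n) K) :
    Finset (PolVar c) → MvPolynomial (PolVar c) K :=
  ∑ J : Finset (Fin n), ∑ a ∈ (f J).support,
    Pi.single (polIndex c a J) (coeff a (f J) • polMonomial K c a)

/-- `f = ∑_J f_J e_J` is multihomogeneous of multidegree `b`, where `deg (u e_J)` is the exponent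
of `u` plus the indicator vector of `J`. -/
def IsMultihomogeneous (f : Finset (Fin n) → MvPolynomial (Fin n) K) (b : Fin n → ℕ) : Prop :=
  ∀ J, ∀ a ∈ (f J).support, ∀ i, a i + (if i ∈ J then 1 else 0) = b i

end Polarization

end KoszulPol

end

noncomputable section

namespace KoszulPol

/-! ### Simplicial chains: coning with a vertex and clearing vertices. -/

section Contraction

variable {ι K : Type*} [LinearOrder ι]

/-! Both Koszul complexes split by multidegree. For a monomial ideal, the strand of degree `β` is
the chain complex, empty face included, of the upper Koszul complex, whose faces are the `J` with
`x^β / x^J` in the ideal (`component_koszulD`, `mem_koszulChains_iff`). Being a cycle or a boundary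
is therefore decided degree by degree, by simplicial chains over `K` (`mem_koszulCycles_iff`,
`mem_koszulBoundaries_iff`).

For `I^℘` there are two kinds of degrees. If `β` is not the exponent of any `x^b` polarized with `b
≤ c`, then some variable `v` occurs in `x^β` to a higher power than in every generator dividing
`x^β`. Faces can then be enlarged by `v`, the complex is a cone, and the homology vanishes
(`exists_simplexD_eq_of_ne_polExp`).

If `β` is the polarization of `b ≤ c`, the faces using only the last variables `x_{i,b_i}` form a
copy of the upper Koszul complex of `I` in degree `b`, and `f ↦ f^℘` is this identification, signs
included (`simplexD_polPush`, `component_polChain`). A face containing any other `x_{ij}` can be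
enlarged by `x_{i,b_i}`, so chains can be pushed onto the copy modulo boundaries
(`exists_sub_simplexD_mem_avoiding`). Pushing primitives gives injectivity on homology, hence linear
independence (`exists_simplexD_eq_of_polPush`); pushing cycles gives surjectivity, hence spanning
(`exists_polPush_add_simplexD_eq`). -/

lemma koszulSign_mul_self (j : ι) (J : Finset ι) : koszulSign j J * koszulSign j J = 1 := by
  rw [koszulSign, ← mul_pow]; simp

lemma koszulSign_insert_self (j : ι) (J : Finset ι) :
    koszulSign j (insert j J) = koszulSign j J := by
  rw [koszulSign, Finset.filter_insert, if_neg (lt_irrefl j), koszulSign]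

lemma koszulSign_anticomm {j k : ι} {J : Finset ι} (hjk : j ≠ k) (hj : j ∉ J) (hk : k ∉ J) :
    koszulSign j J * koszulSign k (insert j J) = -(koszulSign k J * koszulSign j (insert k J)) := by
  rcases lt_or_gt_of_ne hjk with h | h
  · exact koszulSign_swap hj h
  · rw [koszulSign_swap hk h, neg_neg]

variable [CommRing K]

/-- Exterior multiplication by the basis element of the vertex `v`. -/
def cone (v : ι) (φ : Finset ι → K) (J : Finset ι) : K :=
  if v ∈ J then koszulSign v J • φ (J.erase v) else 0

/-- The chains supported on the sets with `p` elements that satisfy `Δ`. -/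
def faceChains (K : Type*) [CommRing K] (Δ : Finset ι → Prop) (p : ℕ) :
    Submodule K (Finset ι → K) where
  carrier := {φ | ∀ J, φ J ≠ 0 → J.card = p ∧ Δ J}
  add_mem' := by
    intro f g hf hg J h
    by_cases h' : f J = 0
    · exact hg J (by simpa [h'] using h)
    · exact hf J h'
  zero_mem' := by simp
  smul_mem' := by
    intro r f hf J h
    exact hf J (fun h' => h (by simp [h']))

lemma cone_mem_faceChains {Δ Δ' : Finset ι → Prop} {p : ℕ} {v : ι}
    (hv : ∀ J, v ∉ J → Δ J → Δ' (insert v J)) {φ : Finset ι → K} (h : φ ∈ faceChains K Δ p) :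
    cone v φ ∈ faceChains K Δ' (p + 1) := by
  intro J hJ
  rw [cone] at hJ
  split_ifs at hJ with hvJ
  · obtain ⟨h1, h2⟩ := h (J.erase v) (fun e => hJ (by rw [e, smul_zero]))
    have := hv _ (Finset.notMem_erase v J) h2
    rw [Finset.insert_erase hvJ] at this
    exact ⟨by rw [← Finset.card_erase_add_one hvJ, h1], this⟩
  · exact absurd rfl hJ

/-- The chains that vanish on every set meeting `B`. -/
def avoiding (K : Type*) [CommRing K] (B : Set ι) : Submodule K (Finset ι → K) where
  carrier := {φ | ∀ J : Finset ι, (∃ v ∈ J, v ∈ B) → φ J = 0}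
  add_mem' := by
    intro f g hf hg J h
    simp [hf J h, hg J h]
  zero_mem' := by simp
  smul_mem' := by
    intro r f hf J h
    simp [hf J h]

lemma cone_mem_avoiding {B : Set ι} {v : ι} (hv : v ∉ B) {φ : Finset ι → K}
    (h : φ ∈ avoiding K B) : cone v φ ∈ avoiding K B := by
  rintro J ⟨k, hk, hB⟩
  rw [cone]
  split_ifs
  · rw [h _ ⟨k, Finset.mem_erase.2 ⟨by rintro rfl; exact hv hB, hk⟩, hB⟩, smul_zero]
  · rfl

variable [Fintype ι]

/-- The boundary of the full simplex on `ι`, with coefficients in `K`. -/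
abbrev simplexD (ι K : Type*) [LinearOrder ι] [Fintype ι] [CommRing K] :
    (Finset ι → K) →ₗ[K] (Finset ι → K) :=
  koszulD (fun _ : ι => (1 : K))

lemma simplexD_apply (φ : Finset ι → K) (J : Finset ι) :
    simplexD ι K φ J = ∑ j ∈ Jᶜ, koszulSign j J • φ (insert j J) := by
  change ∑ j ∈ Jᶜ, koszulSign j J • ((1 : K) * φ (insert j J)) = _
  simp only [one_mul]

/-- The contracting homotopy `∂(e_v ∧ φ) + e_v ∧ ∂φ = φ`. On faces containing `v`, the terms that
add a further vertex `k` cancel because `e_v` and `e_k` anticommute. -/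
lemma simplexD_cone_add (v : ι) (φ : Finset ι → K) :
    simplexD ι K (cone v φ) + cone v (simplexD ι K φ) = φ := by
  funext J
  rw [Pi.add_apply, simplexD_apply, cone]
  by_cases hv : v ∈ J
  · obtain ⟨L, hvL, rfl⟩ : ∃ L, v ∉ L ∧ insert v L = J :=
      ⟨J.erase v, Finset.notMem_erase v J, Finset.insert_erase hv⟩
    rw [if_pos hv, Finset.erase_insert hvL, simplexD_apply,
      show Lᶜ = insert v (insert v L)ᶜ from by
        ext k; simp only [Finset.mem_compl, Finset.mem_insert]; by_cases h : k = v <;> simp [h, hvL],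
      Finset.sum_insert (by simp), smul_add, smul_smul, koszulSign_insert_self,
      koszulSign_mul_self, one_smul, add_comm, add_assoc, Finset.smul_sum,
      ← Finset.sum_add_distrib, Finset.sum_eq_zero, add_zero]
    intro k hk
    simp only [Finset.mem_compl, Finset.mem_insert, not_or] at hk
    rw [cone, if_pos (by simp), Finset.insert_comm, Finset.erase_insert (by simp [hvL, Ne.symm hk.1]),
      koszulSign_insert_self, smul_smul, smul_smul, ← add_smul]
    have h1 := koszulSign_anticomm (Ne.symm hk.1) hvL hk.2
    -- This is `h1` multiplied by the two signs of `v`, whose squares are `1`.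
    have h2 : koszulSign k (insert v L) * koszulSign v (insert k L) =
        -(koszulSign v L * koszulSign k L) := by
      have ha := koszulSign_mul_self v L
      have hb := koszulSign_mul_self v (insert k L)
      linear_combination (koszulSign v L * koszulSign v (insert k L)) * h1
        - koszulSign k (insert v L) * koszulSign v (insert k L) * ha
        - koszulSign k L * koszulSign v L * hb
    rw [h2]; simp
  · rw [if_neg hv, add_zero, Finset.sum_eq_single v]
    · rw [cone, if_pos (by simp), Finset.erase_insert hv, koszulSign_insert_self, smul_smul,
        koszulSign_mul_self, one_smul]
    · intro k _ hk
      rw [cone, if_neg (by simp [hv, Ne.symm hk]), smul_zero]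
    · intro h; simp [hv] at h

lemma simplexD_mem_avoiding {B : Set ι} {φ : Finset ι → K} (h : φ ∈ avoiding K B) :
    simplexD ι K φ ∈ avoiding K B := by
  rintro J ⟨v, hv, hB⟩
  rw [simplexD_apply]
  exact Finset.sum_eq_zero fun j _ => by rw [h _ ⟨v, Finset.mem_insert_of_mem hv, hB⟩, smul_zero]

lemma simplexD_mem_faceChains {Δ : Finset ι → Prop} {p : ℕ}
    (hΔ : ∀ J v, Δ (insert v J) → Δ J) {φ : Finset ι → K} (h : φ ∈ faceChains K Δ (p + 1)) :
    simplexD ι K φ ∈ faceChains K Δ p := by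
  intro J hJ
  rw [simplexD_apply] at hJ
  obtain ⟨j, hj, hne⟩ := Finset.exists_ne_zero_of_sum_ne_zero hJ
  obtain ⟨h1, h2⟩ := h (insert j J) (fun e => hne (by rw [e, smul_zero]))
  rw [Finset.card_insert_of_notMem (by simpa using hj)] at h1
  exact ⟨by omega, hΔ J j h2⟩

/-- A complex that is closed under adding a vertex `v` is acyclic. -/
lemma exists_simplexD_eq_of_insert {Δ : Finset ι → Prop} {p : ℕ} {v : ι}
    (hv : ∀ J, v ∉ J → Δ J → Δ (insert v J)) {φ : Finset ι → K} (h : φ ∈ faceChains K Δ p)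
    (hφ : simplexD ι K φ = 0) : ∃ θ ∈ faceChains K Δ (p + 1), simplexD ι K θ = φ := by
  refine ⟨cone v φ, cone_mem_faceChains hv h, ?_⟩
  have := simplexD_cone_add v φ
  rwa [hφ, show cone v (0 : Finset ι → K) = 0 from by funext J; simp [cone], add_zero] at this

/-- Let `ψ₁` be the part of `ψ` on faces meeting `B`; these are the faces that `v` can be added to.
By the cone homotopy, `ψ - ∂(e_v ∧ ψ₁) = (ψ - ψ₁) + e_v ∧ ∂ψ₁`, and `∂ψ₁ = ∂ψ - ∂(ψ - ψ₁)` avoids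
`B`. The set `C` records what has been cleared before, so that the step can be iterated. -/
lemma exists_sub_simplexD_mem_avoiding_union {Δ : Finset ι → Prop} {p : ℕ} {v : ι} {B C : Set ι}
    (hvB : v ∉ B) (hvC : v ∉ C)
    (hv : ∀ J, Δ J → (∃ k ∈ J, k ∈ B) → Δ (insert v J)) {ψ : Finset ι → K}
    (h : ψ ∈ faceChains K Δ p) (hψ : simplexD ι K ψ ∈ avoiding K B) (hC : ψ ∈ avoiding K C) :
    ∃ θ ∈ faceChains K Δ (p + 1), ψ - simplexD ι K θ ∈ avoiding K (B ∪ C) := by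
  classical
  let ψ₁ : Finset ι → K := fun J => if ∃ k ∈ J, k ∈ B then ψ J else 0
  have h₀ : ψ - ψ₁ ∈ avoiding K B := fun J hJ => by simp [ψ₁, if_pos hJ]
  have h₁ : ψ₁ ∈ faceChains K (fun J => Δ J ∧ ∃ k ∈ J, k ∈ B) p := by
    intro J hJ
    simp only [ψ₁] at hJ
    split_ifs at hJ with hB
    · exact ⟨(h J hJ).1, (h J hJ).2, hB⟩
    · exact absurd rfl hJ
  have h₁C : ψ₁ ∈ avoiding K C := fun J hJ => by simp [ψ₁, hC J hJ]
  refine ⟨cone v ψ₁, cone_mem_faceChains (fun J _ hJ => hv J hJ.1 hJ.2) h₁, ?_⟩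
  have hB' : ψ - simplexD ι K (cone v ψ₁) ∈ avoiding K B := by
    have e : ψ - simplexD ι K (cone v ψ₁) = (ψ - ψ₁) + cone v (simplexD ι K ψ₁) := by
      rw [sub_add, sub_right_inj]
      exact eq_sub_of_add_eq (simplexD_cone_add v ψ₁)
    have e' : simplexD ι K ψ₁ = simplexD ι K ψ - simplexD ι K (ψ - ψ₁) := by
      rw [map_sub, sub_sub_cancel]
    rw [e]
    refine add_mem h₀ (cone_mem_avoiding hvB ?_)
    rw [e']
    exact sub_mem hψ (simplexD_mem_avoiding h₀)
  have hC' : ψ - simplexD ι K (cone v ψ₁) ∈ avoiding K C :=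
    sub_mem hC (simplexD_mem_avoiding (cone_mem_avoiding hvC h₁C))
  rintro J ⟨k, hk, hkB | hkC⟩
  · exact hB' J ⟨k, hk, hkB⟩
  · exact hC' J ⟨k, hk, hkC⟩

end Contraction

/-! ### Multigraded strands of the Koszul complex and upper Koszul complexes. -/

section Components

variable {ι K : Type*} [Field K]

lemma monomial_mem_span_iff (A : Set (ι →₀ ℕ)) (a : ι →₀ ℕ) :
    monomial a (1 : K) ∈ Ideal.span ((fun a => monomial a (1 : K)) '' A) ↔ ∃ s ∈ A, s ≤ a := by
  rw [mem_ideal_span_monomial_image]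
  classical simp [coeff_monomial]

/-- The ideal contains the monomials of all its elements. -/
def HasMonomialSupport (I : Ideal (MvPolynomial ι K)) : Prop :=
  ∀ f : MvPolynomial ι K, f ∈ I ↔ ∀ a ∈ f.support, monomial a (1 : K) ∈ I

lemma hasMonomialSupport_span (A : Set (ι →₀ ℕ)) :
    HasMonomialSupport (Ideal.span ((fun a => monomial a (1 : K)) '' A)) := by
  intro f
  rw [mem_ideal_span_monomial_image]
  exact forall₂_congr fun a _ => (monomial_mem_span_iff A a).symm

variable [LinearOrder ι] [Fintype ι]

/-- The exponent of the squarefree monomial `∏_{j ∈ J} x_j`. -/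
def indicatorExp (J : Finset ι) : ι →₀ ℕ :=
  Finsupp.equivFunOnFinite.symm fun j => if j ∈ J then 1 else 0

@[simp] lemma indicatorExp_apply (J : Finset ι) (j : ι) :
    indicatorExp J j = if j ∈ J then 1 else 0 := rfl

/-- The coefficients of the component of multidegree `β` of an element of the Koszul complex. -/
def component (K : Type*) [Field K] (β : ι →₀ ℕ) :
    (Finset ι → MvPolynomial ι K) →ₗ[K] (Finset ι → K) where
  toFun f J := coeff β (monomial (indicatorExp J) 1 * f J)
  map_add' f g := by funext J; simp [mul_add]
  map_smul' r f := by funext J; simp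

lemma component_apply (β : ι →₀ ℕ) (f : Finset ι → MvPolynomial ι K) (J : Finset ι) :
    component K β f J = coeff β (monomial (indicatorExp J) 1 * f J) := rfl

lemma component_apply' (β : ι →₀ ℕ) (f : Finset ι → MvPolynomial ι K) (J : Finset ι) :
    component K β f J = if indicatorExp J ≤ β then coeff (β - indicatorExp J) (f J) else 0 := by
  rw [component_apply, coeff_monomial_mul']
  simp

lemma component_add_indicatorExp (a : ι →₀ ℕ) (f : Finset ι → MvPolynomial ι K) (J : Finset ι) :
    component K (a + indicatorExp J) f J = coeff a (f J) := by
  rw [component_apply', if_pos (by simp), add_tsub_cancel_right]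

lemma component_ext {f g : Finset ι → MvPolynomial ι K}
    (h : ∀ β, component K β f = component K β g) : f = g := by
  funext J
  ext a
  rw [← component_add_indicatorExp, h, component_add_indicatorExp]

/-- Replacing `e_J` by `x^J` absorbs the factor `x_j` of the differential, since `x^J x_j = x^{J ∪
{j}}`; only the signs remain. -/
lemma component_koszulD (β : ι →₀ ℕ) (f : Finset ι → MvPolynomial ι K) :
    component K β (koszulD X f) = simplexD ι K (component K β f) := by
  funext J
  rw [simplexD_apply, component_apply]
  change coeff β (_ * ∑ j ∈ Jᶜ, koszulSign j J • (X j * f (insert j J))) = _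
  rw [Finset.mul_sum, coeff_sum]
  refine Finset.sum_congr rfl fun j hj => ?_
  have : (monomial (indicatorExp (insert j J)) (1 : K)) = monomial (indicatorExp J) 1 * X j := by
    rw [X, monomial_mul, one_mul]
    refine congrArg (fun m => monomial m (1 : K)) (Finsupp.ext fun k => ?_)
    by_cases h : k = j
    · subst h; simp_all
    · simp [h]
  rw [component_apply, this, mul_smul_comm, mul_assoc, ← coeffAddMonoidHom_apply, map_zsmul,
    coeffAddMonoidHom_apply]

/-- The faces of the upper Koszul complex of `I` in degree `β`. -/
def IsKoszulFace (I : Ideal (MvPolynomial ι K)) (β : ι →₀ ℕ) (J : Finset ι) : Prop :=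
  indicatorExp J ≤ β ∧ monomial (β - indicatorExp J) (1 : K) ∈ I

lemma isKoszulFace_iff_of_generators {I : Ideal (MvPolynomial ι K)} {A : Set (ι →₀ ℕ)}
    (hA : ∀ a, monomial a (1 : K) ∈ I ↔ ∃ s ∈ A, s ≤ a) {β : ι →₀ ℕ} {J : Finset ι} :
    IsKoszulFace I β J ↔ ∃ s ∈ A, s + indicatorExp J ≤ β := by
  rw [IsKoszulFace, hA]
  constructor
  · rintro ⟨h, s, hs, hle⟩
    exact ⟨s, hs, (le_tsub_iff_right h).1 hle⟩
  · rintro ⟨s, hs, hle⟩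
    have h : indicatorExp J ≤ β := le_trans (by simp) hle
    exact ⟨h, s, hs, (le_tsub_iff_right h).2 hle⟩

lemma mem_koszulChains_iff {I : Ideal (MvPolynomial ι K)} (hI : HasMonomialSupport I) {p : ℕ}
    {f : Finset ι → MvPolynomial ι K} :
    f ∈ koszulChains I p ↔ ∀ β, component K β f ∈ faceChains K (IsKoszulFace I β) p := by
  constructor
  · rintro ⟨h1, h2⟩ β J hJ
    rw [component_apply'] at hJ
    split_ifs at hJ with hle
    · refine ⟨?_, hle, ?_⟩
      · by_contra hc
        exact hJ (by rw [h2 J hc, coeff_zero])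
      · exact (hI _).1 (h1 J) _ (mem_support_iff.2 hJ)
    · exact absurd rfl hJ
  · intro h
    have key : ∀ J a, coeff a (f J) ≠ 0 → J.card = p ∧ monomial a (1 : K) ∈ I := by
      intro J a ha
      rw [← component_add_indicatorExp] at ha
      obtain ⟨h1, -, h2⟩ := h _ J ha
      rw [add_tsub_cancel_right] at h2
      exact ⟨h1, h2⟩
    refine ⟨fun J => (hI _).2 fun a ha => (key J a (mem_support_iff.1 ha)).2, fun J hJ => ?_⟩
    ext a
    rw [coeff_zero]
    by_contra ha
    exact hJ (key J a ha).1

lemma exists_component_ne_zero_finset (f : Finset ι → MvPolynomial ι K) :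
    ∃ F : Finset (ι →₀ ℕ), ∀ β ∉ F, component K β f = 0 := by
  classical
  refine ⟨Finset.univ.biUnion fun J => (f J).support.image (· + indicatorExp J), fun β hβ => ?_⟩
  funext J
  by_contra h
  rw [component_apply'] at h
  split_ifs at h with hle
  · refine hβ (Finset.mem_biUnion.2 ⟨J, Finset.mem_univ _, Finset.mem_image.2
      ⟨β - indicatorExp J, mem_support_iff.2 h, tsub_add_cancel_of_le hle⟩⟩)
  · exact h rfl

/-- The strands can be prescribed independently; the finite set `F` is what makes the coefficients
polynomials. -/
lemma exists_koszulChain_component_eq {I : Ideal (MvPolynomial ι K)} (hI : HasMonomialSupport I)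
    {p : ℕ} (θ : (ι →₀ ℕ) → Finset ι → K) (F : Finset (ι →₀ ℕ)) (hF : ∀ β ∉ F, θ β = 0)
    (hθ : ∀ β, θ β ∈ faceChains K (IsKoszulFace I β) p) :
    ∃ f ∈ koszulChains I p, ∀ β, component K β f = θ β := by
  classical
  have key : ∀ γ, component K γ (∑ β ∈ F, fun J => monomial (β - indicatorExp J) (θ β J)) =
      θ γ := by
    intro γ
    funext J
    rw [map_sum, Finset.sum_apply]
    have : ∀ β, component K γ (fun J => monomial (β - indicatorExp J) (θ β J)) J =
        if γ = β then θ γ J else 0 := by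
      intro β
      rw [component_apply, monomial_mul, one_mul, coeff_monomial]
      by_cases h0 : θ β J = 0
      · split_ifs with h1 h2 h2
        · rw [h2]
        · exact h0
        · rw [h2, h0]
        · rfl
      -- A nonzero coefficient sits on a face, so the subtraction `β - indicatorExp J` is not
      -- truncated.
      · rw [add_tsub_cancel_of_le (hθ β J h0).2.1]
        split_ifs with h1 h2 h2
        · rw [h2]
        · exact absurd h1.symm h2
        · exact absurd h2.symm h1
        · rfl
    simp only [this]
    rw [Finset.sum_ite_eq]
    split_ifs with h
    · rfl
    · rw [hF γ h]; rfl
  exact ⟨_, (mem_koszulChains_iff hI).2 fun β => by rw [key]; exact hθ β, key⟩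

lemma mem_koszulCycles_iff {I : Ideal (MvPolynomial ι K)} (hI : HasMonomialSupport I) {p : ℕ}
    {f : Finset ι → MvPolynomial ι K} :
    f ∈ koszulCycles X I p ↔ ∀ β, component K β f ∈ faceChains K (IsKoszulFace I β) p ∧
      simplexD ι K (component K β f) = 0 := by
  rw [koszulCycles, Submodule.mem_inf, mem_koszulChains_iff hI, LinearMap.mem_ker, forall_and]
  refine and_congr_right fun _ => ⟨fun h β => ?_, fun h => component_ext fun β => ?_⟩
  · rw [← component_koszulD, h, map_zero]
  · rw [component_koszulD, h, map_zero]

lemma mem_koszulBoundaries_iff {I : Ideal (MvPolynomial ι K)} (hI : HasMonomialSupport I) {p : ℕ}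
    {f : Finset ι → MvPolynomial ι K} :
    f ∈ koszulBoundaries X I p ↔ ∀ β, ∃ θ ∈ faceChains K (IsKoszulFace I β) (p + 1),
      simplexD ι K θ = component K β f := by
  classical
  constructor
  · rintro ⟨g, hg, rfl⟩ β
    exact ⟨component K β g, (mem_koszulChains_iff hI).1 hg β, (component_koszulD β g).symm⟩
  · intro h
    choose θ hθ hd using h
    obtain ⟨F, hF⟩ := exists_component_ne_zero_finset f
    -- The chosen primitives may be nonzero even where `f` has no component, so they are cut off
    -- outside the finite set `F`.
    obtain ⟨g, hg, hgθ⟩ := exists_koszulChain_component_eq hI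
      (fun β => if β ∈ F then θ β else 0) F (fun β hβ => if_neg hβ) (p := p + 1) (by
        intro β
        split_ifs
        · exact hθ β
        · exact zero_mem _)
    refine ⟨g, hg, component_ext fun β => ?_⟩
    rw [component_koszulD, hgθ]
    split_ifs with hβ
    · exact hd β
    · rw [hF β hβ, map_zero]

end Components

/-! ### Bases of homology expressed by cycles and boundaries. -/

section Homology

variable {ι K : Type*} [LinearOrder ι] [Fintype ι] [Field K]

lemma sum_smul_homologyClass_eq_iff {I : Ideal (MvPolynomial ι K)} {p r : ℕ}
    (z : Fin r → koszulCycles (X : ι → MvPolynomial ι K) I p) (g : Fin r → K)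
    (w : koszulCycles (X : ι → MvPolynomial ι K) I p) :
    homologyClass X I p w = ∑ k, g k • homologyClass X I p (z k) ↔
      w.1 - ∑ k, g k • (z k).1 ∈ koszulBoundaries X I p := by
  have : ∑ k, g k • homologyClass X I p (z k) = homologyClass X I p (∑ k, g k • z k) := by
    have := map_sum ((Submodule.mkQ ((koszulBoundaries X I p).submoduleOf
      (koszulCycles (X : ι → MvPolynomial ι K) I p))).restrictScalars K) (fun k => g k • z k)
      Finset.univ
    simp only [map_smul] at this
    exact this.symm
  rw [this, homologyClass, homologyClass, Submodule.Quotient.eq, Submodule.submoduleOf,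
    Submodule.mem_comap]
  simp

lemma linearIndependent_homologyClass_iff {I : Ideal (MvPolynomial ι K)} {p r : ℕ}
    (z : Fin r → koszulCycles (X : ι → MvPolynomial ι K) I p) :
    LinearIndependent K (fun k => homologyClass X I p (z k)) ↔
      ∀ g : Fin r → K, ∑ k, g k • (z k).1 ∈ koszulBoundaries X I p → ∀ k, g k = 0 := by
  rw [Fintype.linearIndependent_iff]
  refine forall_congr' fun g => imp_congr_left ?_
  have := sum_smul_homologyClass_eq_iff z g 0
  rw [Submodule.coe_zero, zero_sub, neg_mem_iff] at this
  rw [← this, eq_comm]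
  rfl

lemma span_homologyClass_eq_top_iff {I : Ideal (MvPolynomial ι K)} {p r : ℕ}
    (z : Fin r → koszulCycles (X : ι → MvPolynomial ι K) I p) :
    Submodule.span K (Set.range fun k => homologyClass X I p (z k)) = ⊤ ↔
      ∀ w ∈ koszulCycles X I p, ∃ g : Fin r → K,
        w - ∑ k, g k • (z k).1 ∈ koszulBoundaries X I p := by
  rw [Submodule.eq_top_iff']
  constructor
  · intro h w hw
    obtain ⟨g, hg⟩ := (Submodule.mem_span_range_iff_exists_fun K).1
      (h (homologyClass X I p ⟨w, hw⟩))
    exact ⟨g, (sum_smul_homologyClass_eq_iff z g ⟨w, hw⟩).1 hg.symm⟩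
  · intro h x
    obtain ⟨w, rfl⟩ := Submodule.Quotient.mk_surjective _ x
    obtain ⟨g, hg⟩ := h w.1 w.2
    exact (Submodule.mem_span_range_iff_exists_fun K).2
      ⟨g, ((sum_smul_homologyClass_eq_iff z g w).2 hg).symm⟩

end Homology

/-! ### Polarized exponents, last variables, and the transfer of chains. -/

section PolarizedDegrees

variable {n : ℕ} (c : Fin n → ℕ)

@[reducible]
-- Makes set operations on the variables use the equality test of the linear order, as in the Koszul
-- differential.
instance PolVar.decidableEq : DecidableEq (PolVar c) := fun v w => LinearOrder.toDecidableEq v w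

/-- The exponent of the polarization of the monomial with exponent `a`. -/
def polExp (a : Fin n →₀ ℕ) : PolVar c →₀ ℕ :=
  Finsupp.equivFunOnFinite.symm fun v => if ((ofLex v).2 : ℕ) < a (ofLex v).1 then 1 else 0

variable {c}

lemma polExp_apply (a : Fin n →₀ ℕ) (v : PolVar c) :
    polExp c a v = if ((ofLex v).2 : ℕ) < a (ofLex v).1 then 1 else 0 := rfl

lemma polMonomial_eq {K : Type*} [Field K] (a : Fin n →₀ ℕ) :
    polMonomial K c a = monomial (polExp c a) 1 := by
  rw [monomial_eq, C_1, one_mul, Finsupp.prod_fintype _ _ (fun _ => pow_zero _), polMonomial,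
    ← (toLex : (Σ i : Fin n, Fin (c i)) ≃ PolVar c).prod_comp, Fintype.prod_sigma]
  refine Finset.prod_congr rfl fun i _ => ?_
  rw [Finset.prod_filter]
  refine Finset.prod_congr rfl fun j _ => ?_
  rw [polExp_apply]
  change (if (j : ℕ) < a i then _ else _) = _ ^ (if (j : ℕ) < a i then 1 else 0)
  split_ifs <;> simp

/-- If `b i < b' i`, the two polarizations differ at the variable with zero-based index `b i`. It
exists because `b' ≤ c`; beyond `c` polarization truncates. -/
lemma polExp_injective {b b' : Fin n →₀ ℕ} (hb : ⇑b ≤ c) (hb' : ⇑b' ≤ c)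
    (h : polExp c b = polExp c b') : b = b' := by
  have key : ∀ {b b' : Fin n →₀ ℕ}, ⇑b' ≤ c → polExp c b = polExp c b' → b' ≤ b := by
    intro b b' hb' h i
    by_contra! hlt
    have := DFunLike.congr_fun h (toLex ⟨i, ⟨b i, hlt.trans_le (hb' i)⟩⟩)
    rw [polExp_apply, polExp_apply, if_neg (by simp), if_pos (by simpa using hlt)] at this
    exact zero_ne_one this
  exact le_antisymm (key hb h.symm) (key hb' h)

/-- Polarized monomials are the squarefree ones whose variables form an initial segment in each row
`x_{i1}, x_{i2}, …`. -/
lemma exists_eq_polExp (β : PolVar c →₀ ℕ) (h1 : ∀ v, β v ≤ 1)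
    (h2 : ∀ v w : PolVar c, (ofLex v).1 = (ofLex w).1 → ((ofLex w).2 : ℕ) < (ofLex v).2 →
      0 < β v → 0 < β w) : ∃ b : Fin n →₀ ℕ, ⇑b ≤ c ∧ polExp c b = β := by
  classical
  -- The `+ 1` turns the largest zero-based index into the length of the segment; an empty row gives
  -- `0`.
  let b : Fin n → ℕ := fun i =>
    (Finset.univ.filter fun j : Fin (c i) => 0 < β (toLex ⟨i, j⟩)).sup fun j => (j : ℕ) + 1
  refine ⟨Finsupp.equivFunOnFinite.symm b, fun i => show b i ≤ c i from Finset.sup_le fun j _ => Nat.succ_le_of_lt j.2, ?_⟩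
  ext v
  obtain ⟨⟨i, j⟩, rfl⟩ := toLex.surjective v
  rw [polExp_apply]
  change (if (j : ℕ) < b i then 1 else 0) = _
  have : (j : ℕ) < b i ↔ 0 < β (toLex ⟨i, j⟩) := by
    rw [Finset.lt_sup_iff]
    constructor
    · rintro ⟨k, hk, hjk⟩
      rw [Finset.mem_filter] at hk
      rcases eq_or_ne j k with rfl | hne
      · exact hk.2
      · refine h2 (toLex ⟨i, k⟩) (toLex ⟨i, j⟩) rfl ?_ hk.2
        have : (j : ℕ) ≠ k := fun e => hne (Fin.ext e)
        change (j : ℕ) < k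
        omega
    · intro h
      exact ⟨j, by simpa using h, Nat.lt_succ_self _⟩
  have hj := h1 (toLex ⟨i, j⟩)
  split_ifs with h
  · have := this.1 h; omega
  · have := mt this.2 h; omega

variable (c)

/-- The last variables `x_{i, b_i}` that occur in the polarization of degree `b`. -/
def topVars (b : Fin n →₀ ℕ) : Finset (PolVar c) :=
  Finset.univ.filter fun v => ((ofLex v).2 : ℕ) + 1 = b (ofLex v).1

/-- The set of the last variables `x_{i, b_i}` with `i ∈ J`. -/
def topFace (b : Fin n →₀ ℕ) (J : Finset (Fin n)) : Finset (PolVar c) :=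
  Finset.univ.filter fun v => (ofLex v).1 ∈ J ∧ ((ofLex v).2 : ℕ) + 1 = b (ofLex v).1

variable {c}

/-- The set of the first indices of a set of variables `x_{ij}`. -/
def shadow (L : Finset (PolVar c)) : Finset (Fin n) := L.image fun v => (ofLex v).1

lemma mem_topVars {b : Fin n →₀ ℕ} {v : PolVar c} :
    v ∈ topVars c b ↔ ((ofLex v).2 : ℕ) + 1 = b (ofLex v).1 := by simp [topVars]

lemma mem_topFace {b : Fin n →₀ ℕ} {J : Finset (Fin n)} {v : PolVar c} :
    v ∈ topFace c b J ↔ (ofLex v).1 ∈ J ∧ ((ofLex v).2 : ℕ) + 1 = b (ofLex v).1 := by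
  simp [topFace]

lemma mem_shadow {L : Finset (PolVar c)} {i : Fin n} :
    i ∈ shadow L ↔ ∃ v ∈ L, (ofLex v).1 = i := by simp [shadow]

lemma PolVar.ext' {v w : PolVar c} (h1 : (ofLex v).1 = (ofLex w).1)
    (h2 : ((ofLex v).2 : ℕ) = (ofLex w).2) : v = w := by
  obtain ⟨⟨i, j⟩, rfl⟩ := toLex.surjective v
  obtain ⟨⟨i', j'⟩, rfl⟩ := toLex.surjective w
  obtain rfl : i = i' := h1
  obtain rfl : j = j' := Fin.ext h2
  rfl

lemma eq_of_mem_topVars {b : Fin n →₀ ℕ} {v w : PolVar c} (hv : v ∈ topVars c b)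
    (hw : w ∈ topVars c b) (h : (ofLex v).1 = (ofLex w).1) : v = w := by
  rw [mem_topVars] at hv hw
  refine PolVar.ext' h ?_
  have := congrArg b h
  omega

lemma exists_mem_topVars {b : Fin n →₀ ℕ} (hb : ⇑b ≤ c) {i : Fin n} (hi : 0 < b i) :
    ∃ v ∈ topVars c b, (ofLex v).1 = i :=
  ⟨toLex ⟨i, ⟨b i - 1, by have : b i ≤ c i := hb i; omega⟩⟩, by
    rw [mem_topVars]; change b i - 1 + 1 = b i; omega, rfl⟩

lemma lt_iff_of_mem_topVars {b : Fin n →₀ ℕ} {v w : PolVar c} (hv : v ∈ topVars c b)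
    (hw : w ∈ topVars c b) : v < w ↔ (ofLex v).1 < (ofLex w).1 := by
  constructor
  · intro h
    rcases Sigma.Lex.lt_def.1 h with h' | ⟨h', -⟩
    · exact h'
    · exact absurd (eq_of_mem_topVars hv hw h') h.ne
  · intro h
    exact Sigma.Lex.lt_def.2 (Or.inl h)

lemma topFace_shadow {b : Fin n →₀ ℕ} {L : Finset (PolVar c)} (hL : L ⊆ topVars c b) :
    topFace c b (shadow L) = L := by
  ext v
  rw [mem_topFace, mem_shadow]
  constructor
  · rintro ⟨⟨w, hw, h⟩, hv⟩
    rwa [← eq_of_mem_topVars (hL hw) (mem_topVars.2 hv) h]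
  · intro hv
    exact ⟨⟨v, hv, rfl⟩, mem_topVars.1 (hL hv)⟩

lemma topFace_subset (b : Fin n →₀ ℕ) (J : Finset (Fin n)) : topFace c b J ⊆ topVars c b :=
  fun _ hv => mem_topVars.2 (mem_topFace.1 hv).2

lemma shadow_topFace {b : Fin n →₀ ℕ} (hb : ⇑b ≤ c) {J : Finset (Fin n)}
    (hJ : ∀ i ∈ J, 0 < b i) : shadow (topFace c b J) = J := by
  ext i
  rw [mem_shadow]
  constructor
  · rintro ⟨v, hv, rfl⟩
    exact (mem_topFace.1 hv).1
  · intro hi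
    obtain ⟨v, hv, rfl⟩ := exists_mem_topVars hb (hJ i hi)
    exact ⟨v, mem_topFace.2 ⟨hi, mem_topVars.1 hv⟩, rfl⟩

lemma card_shadow {b : Fin n →₀ ℕ} {L : Finset (PolVar c)} (hL : L ⊆ topVars c b) :
    (shadow L).card = L.card :=
  Finset.card_image_of_injOn fun _ hv _ hw h => eq_of_mem_topVars (hL hv) (hL hw) h

lemma mem_shadow_iff_of_mem_topVars {b : Fin n →₀ ℕ} {L : Finset (PolVar c)}
    (hL : L ⊆ topVars c b) {v : PolVar c} (hv : v ∈ topVars c b) :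
    (ofLex v).1 ∈ shadow L ↔ v ∈ L := by
  rw [mem_shadow]
  constructor
  · rintro ⟨w, hw, h⟩
    rwa [← eq_of_mem_topVars (hL hw) hv h]
  · intro h
    exact ⟨v, h, rfl⟩

/-- There is at most one last variable in each row, and the lexicographic order compares rows first,
so passing to row indices preserves the order and hence the signs. -/
lemma koszulSign_shadow {b : Fin n →₀ ℕ} {L : Finset (PolVar c)} (hL : L ⊆ topVars c b)
    {v : PolVar c} (hv : v ∈ topVars c b) :
    koszulSign (ofLex v).1 (shadow L) = koszulSign v L := by
  have hsub : L.filter (fun w => w < v) ⊆ topVars c b := (Finset.filter_subset _ _).trans hL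
  rw [koszulSign, koszulSign, ← card_shadow hsub]
  congr 2
  ext i
  simp only [Finset.mem_filter, mem_shadow]
  constructor
  · rintro ⟨⟨w, hw, rfl⟩, h⟩
    exact ⟨w, ⟨hw, (lt_iff_of_mem_topVars (hL hw) hv).2 h⟩, rfl⟩
  · rintro ⟨w, ⟨hw, h⟩, rfl⟩
    exact ⟨⟨w, hw, rfl⟩, (lt_iff_of_mem_topVars (hL hw) hv).1 h⟩

lemma shadow_insert (v : PolVar c) (L : Finset (PolVar c)) :
    shadow (insert v L) = insert (ofLex v).1 (shadow L) := Finset.image_insert _ _ _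

section Push

variable {K : Type*} [Field K]

/-- The polarization of the component of degree `b` of an element of the Koszul complex. -/
def polPush (K : Type*) [Field K] (c : Fin n → ℕ) (b : Fin n →₀ ℕ) :
    (Finset (Fin n) → K) →ₗ[K] (Finset (PolVar c) → K) where
  toFun φ L := if L ⊆ topVars c b then φ (shadow L) else 0
  map_add' φ ψ := by funext L; simp only [Pi.add_apply]; split_ifs <;> simp
  map_smul' a φ := by funext L; simp

lemma polPush_apply (b : Fin n →₀ ℕ) (φ : Finset (Fin n) → K) (L : Finset (PolVar c)) :
    polPush K c b φ L = if L ⊆ topVars c b then φ (shadow L) else 0 := rfl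

lemma polPush_topFace {b : Fin n →₀ ℕ} (hb : ⇑b ≤ c) (φ : Finset (Fin n) → K)
    {J : Finset (Fin n)} (hJ : ∀ i ∈ J, 0 < b i) : polPush K c b φ (topFace c b J) = φ J := by
  rw [polPush_apply, if_pos (topFace_subset b J), shadow_topFace hb hJ]

/-- Positivity is needed because a row with `b i = 0` has no last variable: `topFace` forgets such
an `i`. -/
lemma polPush_injective {b : Fin n →₀ ℕ} (hb : ⇑b ≤ c) {φ ψ : Finset (Fin n) → K}
    (hφ : ∀ J, φ J ≠ 0 → ∀ i ∈ J, 0 < b i) (hψ : ∀ J, ψ J ≠ 0 → ∀ i ∈ J, 0 < b i)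
    (h : polPush K c b φ = polPush K c b ψ) : φ = ψ := by
  funext J
  by_cases hJ : ∀ i ∈ J, 0 < b i
  · rw [← polPush_topFace hb φ hJ, h, polPush_topFace hb ψ hJ]
  · rw [not_imp_comm.1 (hφ J) hJ, not_imp_comm.1 (hψ J) hJ]

/-- Adding a last variable to `L` corresponds to adding its row to the shadow, with the same sign.
All other terms vanish: on the left by the definition of `polPush`, on the right by the positivity
hypothesis. -/
lemma simplexD_polPush {b : Fin n →₀ ℕ} (hb : ⇑b ≤ c) {φ : Finset (Fin n) → K}
    (hφ : ∀ J, φ J ≠ 0 → ∀ i ∈ J, 0 < b i) :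
    simplexD (PolVar c) K (polPush K c b φ) = polPush K c b (simplexD (Fin n) K φ) := by
  funext L
  rw [polPush_apply, simplexD_apply]
  split_ifs with hL
  · rw [simplexD_apply]
    have h1 : ∑ v ∈ Lᶜ, koszulSign v L • polPush K c b φ (insert v L) =
        ∑ v ∈ Lᶜ.filter (· ∈ topVars c b), koszulSign v L • polPush K c b φ (insert v L) := by
      rw [Finset.sum_filter_of_ne]
      intro v _ h
      by_contra hv
      refine h ?_
      rw [polPush_apply, if_neg fun h => hv (h (Finset.mem_insert_self v L)), smul_zero]
    have h2 : ∑ i ∈ (shadow L)ᶜ, koszulSign i (shadow L) • φ (insert i (shadow L)) =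
        ∑ i ∈ (shadow L)ᶜ.filter (0 < b ·), koszulSign i (shadow L) • φ (insert i (shadow L)) := by
      rw [Finset.sum_filter_of_ne]
      intro i _ h
      exact hφ _ (fun e => h (by rw [e, smul_zero])) i (Finset.mem_insert_self _ _)
    rw [h1, h2]
    refine Finset.sum_bij (fun v _ => (ofLex v).1) ?_ ?_ ?_ ?_
    · intro v hv
      rw [Finset.mem_filter, Finset.mem_compl] at hv ⊢
      rw [mem_shadow_iff_of_mem_topVars hL hv.2]
      exact ⟨hv.1, by have := mem_topVars.1 hv.2; omega⟩
    · intro v hv w hw h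
      exact eq_of_mem_topVars (Finset.mem_filter.1 hv).2 (Finset.mem_filter.1 hw).2 h
    · intro i hi
      rw [Finset.mem_filter, Finset.mem_compl] at hi
      obtain ⟨v, hv, rfl⟩ := exists_mem_topVars hb hi.2
      rw [mem_shadow_iff_of_mem_topVars hL hv] at hi
      exact ⟨v, by simp [hi.1, hv], rfl⟩
    · intro v hv
      have hv' := (Finset.mem_filter.1 hv).2
      rw [koszulSign_shadow hL hv', polPush_apply, if_pos (Finset.insert_subset hv' hL),
        shadow_insert]
  · refine Finset.sum_eq_zero fun v _ => ?_
    rw [polPush_apply, if_neg fun h => hL ((Finset.subset_insert v L).trans h), smul_zero]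

end Push

end PolarizedDegrees

/-! ### The upper Koszul complexes of `I` and of its polarization. -/

section Faces

variable {K : Type*} [Field K] {n : ℕ} {c : Fin n → ℕ} {I : Ideal (MvPolynomial (Fin n) K)}

lemma monomial_mem_iff_exists_minGens (a : Fin n →₀ ℕ) :
    monomial a (1 : K) ∈ I ↔ ∃ s ∈ minGens I, s ≤ a := by
  constructor
  · intro h
    obtain ⟨s, hs, hmin⟩ := exists_minimal_le_of_wellFoundedLT
      (fun b => monomial b (1 : K) ∈ I) a h
    exact ⟨s, hmin, hs⟩
  · rintro ⟨s, hs, hle⟩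
    rw [← tsub_add_cancel_of_le hle, ← one_mul (1 : K), ← monomial_mul]
    exact I.mul_mem_left _ (show Minimal (fun b => monomial b (1 : K) ∈ I) s from hs).prop

lemma polIdeal_eq_span : polIdeal c I =
    Ideal.span ((fun a => monomial a (1 : K)) '' (polExp c '' minGens I)) := by
  rw [polIdeal, Set.image_image]
  simp only [polMonomial_eq]

lemma isKoszulFace_iff {b : Fin n →₀ ℕ} {J : Finset (Fin n)} :
    IsKoszulFace I b J ↔ ∃ a ∈ minGens I, a + indicatorExp J ≤ b :=
  isKoszulFace_iff_of_generators monomial_mem_iff_exists_minGens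

lemma isKoszulFace_polIdeal_iff {β : PolVar c →₀ ℕ} {L : Finset (PolVar c)} :
    IsKoszulFace (polIdeal c I) β L ↔ ∃ a ∈ minGens I, polExp c a + indicatorExp L ≤ β := by
  rw [isKoszulFace_iff_of_generators (A := polExp c '' minGens I), Set.exists_mem_image]
  intro a
  rw [polIdeal_eq_span, monomial_mem_span_iff]

lemma IsKoszulFace.pos {b : Fin n →₀ ℕ} {J : Finset (Fin n)} (h : IsKoszulFace I b J) :
    ∀ i ∈ J, 0 < b i := by
  intro i hi
  have := h.1 i
  rw [indicatorExp_apply, if_pos hi] at this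
  omega

lemma IsKoszulFace.of_insert {ι : Type*} [LinearOrder ι] [Fintype ι]
    {I : Ideal (MvPolynomial ι K)} {β : ι →₀ ℕ} {J : Finset ι}
    {v : ι} (h : IsKoszulFace I β (insert v J)) : IsKoszulFace I β J := by
  have hle : indicatorExp J ≤ indicatorExp (insert v J) := by
    intro k
    by_cases hk : k ∈ J <;> simp [hk]
  refine ⟨hle.trans h.1, ?_⟩
  rw [← tsub_add_cancel_of_le (tsub_le_tsub_left hle β), ← one_mul (1 : K), ← monomial_mul]
  exact I.mul_mem_left _ h.2

lemma isKoszulFace_polExp_iff (hI : ∀ a ∈ minGens I, ⇑a ≤ c) {b : Fin n →₀ ℕ}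
    {L : Finset (PolVar c)} : IsKoszulFace (polIdeal c I) (polExp c b) L ↔
      ∃ a ∈ minGens I, a ≤ b ∧
        ∀ v ∈ L, a (ofLex v).1 ≤ (ofLex v).2 ∧ ((ofLex v).2 : ℕ) < b (ofLex v).1 := by
  rw [isKoszulFace_polIdeal_iff]
  refine exists_congr fun a => and_congr_right fun ha => ?_
  constructor
  · intro h
    have h' : ∀ v : PolVar c, (if ((ofLex v).2 : ℕ) < a (ofLex v).1 then 1 else 0) +
      (if v ∈ L then 1 else 0) ≤ if ((ofLex v).2 : ℕ) < b (ofLex v).1 then 1 else 0 := h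
    constructor
    · intro i
      by_contra! hlt
      -- This variable exists because `b i < a i ≤ c i`; it divides the polarized generator but not
      -- the polarization of `x^b`.
      have h0 := h' (toLex ⟨i, ⟨b i, hlt.trans_le (hI a ha i)⟩⟩)
      rw [ofLex_toLex, if_pos hlt, if_neg (lt_irrefl _)] at h0
      omega
    · intro v hv
      have h0 := h' v
      rw [if_pos hv] at h0
      split_ifs at h0 <;> omega
  · rintro ⟨hab, hL⟩ v
    change (if ((ofLex v).2 : ℕ) < a (ofLex v).1 then 1 else 0) +
      (if v ∈ L then 1 else 0) ≤ if ((ofLex v).2 : ℕ) < b (ofLex v).1 then 1 else 0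
    have h1 := hab (ofLex v).1
    have h2 := hL v
    by_cases hv : v ∈ L
    · obtain ⟨h3, h4⟩ := h2 hv
      rw [if_neg (by omega), if_pos hv, if_pos h4]
    · rw [if_neg hv]
      split_ifs <;> omega

lemma polPush_mem_faceChains (hI : ∀ a ∈ minGens I, ⇑a ≤ c) {b : Fin n →₀ ℕ} {p : ℕ}
    {φ : Finset (Fin n) → K} (hφ : φ ∈ faceChains K (IsKoszulFace I b) p) :
    polPush K c b φ ∈ faceChains K (IsKoszulFace (polIdeal c I) (polExp c b)) p := by
  intro L hL
  rw [polPush_apply] at hL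
  split_ifs at hL with hsub
  · obtain ⟨h1, h2⟩ := hφ _ hL
    rw [card_shadow hsub] at h1
    refine ⟨h1, (isKoszulFace_polExp_iff hI).2 ?_⟩
    obtain ⟨a, ha, hab⟩ := isKoszulFace_iff.1 h2
    refine ⟨a, ha, le_trans (by simp) hab, fun v hv => ?_⟩
    have h3 := hab (ofLex v).1
    have h4 := mem_topVars.1 (hsub hv)
    rw [Finsupp.add_apply, indicatorExp_apply, if_pos (mem_shadow.2 ⟨v, hv, rfl⟩)] at h3
    omega
  · exact absurd rfl hL

/-- At the last variable of row `i`, of zero-based index `b i - 1`, the face condition `a i ≤ b i -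
1` says that `a i + 1 ≤ b i`, which is the face condition for `I` at `i`. -/
lemma exists_polPush_eq (hI : ∀ a ∈ minGens I, ⇑a ≤ c) {b : Fin n →₀ ℕ} (hb : ⇑b ≤ c) {p : ℕ}
    {ψ : Finset (PolVar c) → K}
    (hψ : ψ ∈ faceChains K (IsKoszulFace (polIdeal c I) (polExp c b)) p)
    (htop : ψ ∈ avoiding K {v | v ∉ topVars c b}) :
    ∃ φ ∈ faceChains K (IsKoszulFace I b) p, polPush K c b φ = ψ := by
  classical
  refine ⟨fun J => if ∀ i ∈ J, 0 < b i then ψ (topFace c b J) else 0, ?_, ?_⟩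
  · intro J hJ
    dsimp only at hJ
    split_ifs at hJ with hpos
    · obtain ⟨h1, h2⟩ := hψ _ hJ
      rw [← card_shadow (topFace_subset b J), shadow_topFace hb hpos] at h1
      refine ⟨h1, isKoszulFace_iff.2 ?_⟩
      obtain ⟨a, ha, hab, hL⟩ := (isKoszulFace_polExp_iff hI).1 h2
      refine ⟨a, ha, fun i => ?_⟩
      rw [Finsupp.add_apply, indicatorExp_apply]
      split_ifs with hi
      · obtain ⟨v, hv, rfl⟩ := exists_mem_topVars hb (hpos i hi)
        have := (hL v (mem_topFace.2 ⟨hi, mem_topVars.1 hv⟩)).1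
        have := mem_topVars.1 hv
        omega
      · exact hab i
    · exact absurd rfl hJ
  · funext L
    rw [polPush_apply]
    by_cases hL : L ⊆ topVars c b
    · rw [if_pos hL, if_pos, topFace_shadow hL]
      intro i hi
      obtain ⟨v, hv, rfl⟩ := mem_shadow.1 hi
      have := mem_topVars.1 (hL hv)
      omega
    · rw [if_neg hL]
      obtain ⟨v, hv, hv'⟩ := Finset.not_subset.1 hL
      exact (htop L ⟨v, hv, hv'⟩).symm

/-- In a polarized degree, a chain whose boundary is supported on the last variables can be moved
by a boundary to a chain that is itself supported on the last variables. -/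
lemma exists_sub_simplexD_mem_avoiding (hI : ∀ a ∈ minGens I, ⇑a ≤ c) {b : Fin n →₀ ℕ}
    (hb : ⇑b ≤ c) {p : ℕ} {ψ : Finset (PolVar c) → K}
    (hψ : ψ ∈ faceChains K (IsKoszulFace (polIdeal c I) (polExp c b)) p)
    (hd : simplexD (PolVar c) K ψ ∈ avoiding K {v | v ∉ topVars c b}) :
    ∃ θ ∈ faceChains K (IsKoszulFace (polIdeal c I) (polExp c b)) (p + 1),
      ψ - simplexD (PolVar c) K θ ∈ avoiding K {v | v ∉ topVars c b} := by
  -- The rows are cleared one at a time; `A` is the set of rows already treated.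
  have key : ∀ A : Finset (Fin n),
      ∃ θ ∈ faceChains K (IsKoszulFace (polIdeal c I) (polExp c b)) (p + 1),
        ψ - simplexD (PolVar c) K θ ∈ avoiding K {v | (ofLex v).1 ∈ A ∧ v ∉ topVars c b} := by
    intro A
    induction A using Finset.induction_on with
    | empty => exact ⟨0, zero_mem _, by rintro J ⟨v, _, hv, _⟩; simp at hv⟩
    | insert i A hi ih =>
      obtain ⟨θ, hθ, hA⟩ := ih
      have hψ' : ψ - simplexD (PolVar c) K θ ∈
          faceChains K (IsKoszulFace (polIdeal c I) (polExp c b)) p :=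
        sub_mem hψ (simplexD_mem_faceChains (fun _ _ h => h.of_insert) hθ)
      by_cases hbi : 0 < b i
      · obtain ⟨v, hv, rfl⟩ := exists_mem_topVars hb hbi
        -- If a face with generator `a` contains some `w` in the row of `v`, then `a` at this row is
        -- at most the index of `w`, which is less than `b` there. So `a` is at most the index of
        -- `v`, and the same generator shows that `v` can be added.
        obtain ⟨θ', hθ', h'⟩ := exists_sub_simplexD_mem_avoiding_union
          (B := {w | (ofLex w).1 = (ofLex v).1 ∧ w ∉ topVars c b}) (v := v)
          (fun h => h.2 hv) (fun h => h.2 hv) (fun J hJ hB => by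
            obtain ⟨w, hw, hw1, hw2⟩ := hB
            obtain ⟨a, ha, hab, hL⟩ := (isKoszulFace_polExp_iff hI).1 hJ
            refine (isKoszulFace_polExp_iff hI).2 ⟨a, ha, hab, fun k hk => ?_⟩
            rcases Finset.mem_insert.1 hk with rfl | hk
            · have h1 := hL w hw
              have h3 := congrArg a hw1
              have h4 := congrArg b hw1
              have h2 := mem_topVars.1 hv
              omega
            · exact hL k hk) hψ' (by
            rw [map_sub, koszulD_koszulD, sub_zero]
            exact fun J ⟨w, hw, hw'⟩ => hd J ⟨w, hw, hw'.2⟩) hA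
        refine ⟨θ + θ', add_mem hθ hθ', ?_⟩
        rw [map_add, ← sub_sub]
        rintro J ⟨w, hw, hw1, hw2⟩
        rcases Finset.mem_insert.1 hw1 with h | h
        · exact h' J ⟨w, hw, Or.inl ⟨h, hw2⟩⟩
        · exact h' J ⟨w, hw, Or.inr ⟨h, hw2⟩⟩
      -- Here `b i = 0`, and no face contains a variable of row `i`.
      · refine ⟨θ, hθ, ?_⟩
        rintro J ⟨w, hw, hw1, hw2⟩
        rcases Finset.mem_insert.1 hw1 with h | h
        · by_contra hne
          obtain ⟨a, ha, hab, hL⟩ := (isKoszulFace_polExp_iff hI).1 (hψ' J hne).2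
          have := (hL w hw).2
          rw [congrArg b h] at this
          omega
        · exact hA J ⟨w, hw, h, hw2⟩
  obtain ⟨θ, hθ, h⟩ := key Finset.univ
  exact ⟨θ, hθ, fun J ⟨v, hv, hv'⟩ => h J ⟨v, hv, Finset.mem_univ _, hv'⟩⟩

/-- The degrees that are not polarized do not contribute to the homology. -/
lemma exists_simplexD_eq_of_ne_polExp {β : PolVar c →₀ ℕ}
    (hβ : ∀ b : Fin n →₀ ℕ, ⇑b ≤ c → β ≠ polExp c b) {p : ℕ} {φ : Finset (PolVar c) → K}
    (h : φ ∈ faceChains K (IsKoszulFace (polIdeal c I) β) p)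
    (hφ : simplexD (PolVar c) K φ = 0) :
    ∃ θ ∈ faceChains K (IsKoszulFace (polIdeal c I) β) (p + 1),
      simplexD (PolVar c) K θ = φ := by
  have key : ∃ v, ∀ L, v ∉ L → IsKoszulFace (polIdeal c I) β L →
      IsKoszulFace (polIdeal c I) β (insert v L) := by
    -- Such a `v` has room to spare for every generator dividing `x^β`, so it can be added to any
    -- face not containing it.
    suffices ∃ v, ∀ a ∈ minGens I, polExp c a ≤ β → polExp c a v + 1 ≤ β v by
      obtain ⟨v, hv⟩ := this
      refine ⟨v, fun L hvL hL => isKoszulFace_polIdeal_iff.2 ?_⟩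
      obtain ⟨a, ha, hle⟩ := isKoszulFace_polIdeal_iff.1 hL
      refine ⟨a, ha, fun w => ?_⟩
      rw [Finsupp.add_apply, indicatorExp_apply]
      rcases eq_or_ne w v with rfl | hne
      · rw [if_pos (Finset.mem_insert_self _ _)]
        exact hv a ha (le_trans (by simp) hle)
      · have := hle w
        rw [Finsupp.add_apply, indicatorExp_apply] at this
        simpa [hne] using this
    by_contra! hno
    have hle1 : ∀ (a : Fin n →₀ ℕ) v, polExp c a v ≤ 1 := by
      intro a v
      rw [polExp_apply]
      split_ifs <;> omega
    -- Otherwise, at each `v`, some polarized generator dividing `x^β` has the same exponent as `β`.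
    -- This bounds `β v` by `1`, and if `β v` is positive, that generator contains all earlier
    -- variables of the row, hence so does `x^β`.
    obtain ⟨b, hb, hbβ⟩ := exists_eq_polExp β (fun v => by
      obtain ⟨a, -, -, h⟩ := hno v
      have := hle1 a v
      omega) (fun v w hvw hlt hv => by
      obtain ⟨a, -, hle, h⟩ := hno v
      have h1 := hle w
      have h2 := congrArg a hvw
      rw [polExp_apply] at h h1
      split_ifs at h h1 <;> omega)
    exact hβ b hb hbβ.symm
  obtain ⟨v, hv⟩ := key
  exact exists_simplexD_eq_of_insert hv h hφ

end Faces

/-! ### Polarization of chains and its effect on homology in each degree. -/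

section PolarizedChains

variable {K : Type*} [Field K] {n : ℕ} {c : Fin n → ℕ} {I : Ideal (MvPolynomial (Fin n) K)}

lemma pos_of_component_ne_zero {b : Fin n →₀ ℕ} {f : Finset (Fin n) → MvPolynomial (Fin n) K}
    (J : Finset (Fin n)) (hJ : component K b f J ≠ 0) : ∀ i ∈ J, 0 < b i := by
  rw [component_apply'] at hJ
  split_ifs at hJ with h
  · intro i hi
    have := h i
    rw [indicatorExp_apply, if_pos hi] at this
    omega
  · exact absurd rfl hJ

lemma IsMultihomogeneous.add_indicatorExp {f : Finset (Fin n) → MvPolynomial (Fin n) K}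
    {b : Fin n →₀ ℕ} (h : IsMultihomogeneous f b) {J : Finset (Fin n)} {a : Fin n →₀ ℕ}
    (ha : a ∈ (f J).support) : a + indicatorExp J = b :=
  Finsupp.ext fun i => h J a ha i

lemma IsMultihomogeneous.component_eq_zero {f : Finset (Fin n) → MvPolynomial (Fin n) K}
    {b : Fin n →₀ ℕ} (h : IsMultihomogeneous f b) {γ : Fin n →₀ ℕ} (hγ : γ ≠ b) :
    component K γ f = 0 := by
  funext J
  by_contra hne
  rw [component_apply'] at hne
  split_ifs at hne with hle
  · rw [← tsub_add_cancel_of_le hle] at hγ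
    exact hγ (h.add_indicatorExp (mem_support_iff.2 hne))
  · exact hne rfl

/-- Each `f_J` is a scalar multiple of a single monomial, so the sum has at most one term. -/
lemma IsMultihomogeneous.sum_coeff {f : Finset (Fin n) → MvPolynomial (Fin n) K}
    {b : Fin n →₀ ℕ} (h : IsMultihomogeneous f b) (J : Finset (Fin n)) :
    ∑ a ∈ (f J).support, coeff a (f J) = component K b f J := by
  rw [component_apply]
  conv_rhs => rw [(f J).as_sum]
  rw [Finset.mul_sum, coeff_sum]
  refine Finset.sum_congr rfl fun a ha => ?_
  rw [monomial_mul, one_mul, coeff_monomial, if_pos (by rw [add_comm, h.add_indicatorExp ha])]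

lemma polIndex_eq_topFace {a b : Fin n →₀ ℕ} {J : Finset (Fin n)}
    (h : a + indicatorExp J = b) : polIndex c a J = topFace c b J := by
  ext v
  rw [mem_topFace, polIndex, Finset.mem_filter]
  simp only [Finset.mem_univ, true_and]
  refine and_congr_right fun hv => ?_
  rw [← h, Finsupp.add_apply, indicatorExp_apply, if_pos hv]
  omega

lemma indicatorExp_topFace_add_polExp {a b : Fin n →₀ ℕ} {J : Finset (Fin n)}
    (h : a + indicatorExp J = b) :
    indicatorExp (topFace c b J) + polExp c a = polExp c b := by
  ext v
  have h' := DFunLike.congr_fun h (ofLex v).1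
  rw [Finsupp.add_apply, indicatorExp_apply] at h'
  rw [Finsupp.add_apply, indicatorExp_apply, polExp_apply, polExp_apply]
  simp only [mem_topFace]
  by_cases hv : (ofLex v).1 ∈ J
  · rw [if_pos hv] at h'
    simp only [hv, true_and]
    split_ifs <;> omega
  · rw [if_neg hv] at h'
    simp only [hv, false_and, if_false]
    split_ifs <;> omega

/-- Every term `u e_J` of degree `b` polarizes to degree `polExp c b`, on the face of last variables
with rows in `J`. So the polarized chain lives in that one degree, and equals the transfer of the
strand. -/
lemma component_polChain {f : Finset (Fin n) → MvPolynomial (Fin n) K} {b : Fin n →₀ ℕ}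
    (hb : ⇑b ≤ c) (h : IsMultihomogeneous f b) (β : PolVar c →₀ ℕ) :
    component K β (polChain c f) = if polExp c b = β then polPush K c b (component K b f) else 0 := by
  classical
  funext L
  have h1 : component K β (polChain c f) L = ∑ J : Finset (Fin n),
      if L = topFace c b J ∧ polExp c b = β then component K b f J else 0 := by
    rw [polChain, map_sum, Finset.sum_apply]
    refine Finset.sum_congr rfl fun J _ => ?_
    have h2 : ∀ a ∈ (f J).support, component K β (Pi.single (polIndex c a J)
        (coeff a (f J) • polMonomial K c a)) L =
          if L = topFace c b J ∧ polExp c b = β then coeff a (f J) else 0 := by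
      intro a ha
      have hab := h.add_indicatorExp ha
      rw [component_apply, polIndex_eq_topFace hab, polMonomial_eq]
      by_cases hL : L = topFace c b J
      · subst hL
        rw [Pi.single_eq_same, mul_smul_comm, monomial_mul, one_mul, coeff_smul, coeff_monomial,
          indicatorExp_topFace_add_polExp hab]
        simp
      · rw [Pi.single_eq_of_ne hL, mul_zero, coeff_zero, if_neg fun e => hL e.1]
    rw [map_sum, Finset.sum_apply, ← h.sum_coeff]
    trans ∑ a ∈ (f J).support, if L = topFace c b J ∧ polExp c b = β then coeff a (f J) else 0
    · refine Finset.sum_congr rfl fun a ha => ?_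
      convert h2 a ha
    split_ifs
    · rfl
    · exact Finset.sum_const_zero
  rw [h1]
  by_cases hβ : polExp c b = β
  · simp only [hβ, and_true, if_true]
    by_cases hL : L ⊆ topVars c b
    · rw [Finset.sum_eq_single (shadow L), topFace_shadow hL, if_pos rfl, polPush_apply,
        if_pos hL]
      · intro J _ hJ
        by_contra hne
        have hJL : L = topFace c b J := by
          by_contra hJL
          exact hne (if_neg hJL)
        rw [if_pos hJL] at hne
        exact hJ (by rw [hJL, shadow_topFace hb (pos_of_component_ne_zero J hne)])
      · exact fun hn => absurd (Finset.mem_univ _) hn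
    · rw [polPush_apply, if_neg hL]
      refine Finset.sum_eq_zero fun J _ => if_neg ?_
      rintro rfl
      exact hL (topFace_subset b J)
  · simp [hβ]

lemma component_polChain_polExp {f : Finset (Fin n) → MvPolynomial (Fin n) K} {b : Fin n →₀ ℕ}
    (hb : ⇑b ≤ c) (h : IsMultihomogeneous f b) {γ : Fin n →₀ ℕ} (hγ : ⇑γ ≤ c) :
    component K (polExp c γ) (polChain c f) = polPush K c γ (component K γ f) := by
  rw [component_polChain hb h]
  split_ifs with heq
  · rw [polExp_injective hb hγ heq]
  · rw [h.component_eq_zero fun e => heq (by rw [e]), map_zero]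

lemma hasMonomialSupport_polIdeal : HasMonomialSupport (polIdeal c I) := by
  rw [polIdeal_eq_span]
  exact hasMonomialSupport_span _

lemma IsMonomialIdeal.hasMonomialSupport (hI : IsMonomialIdeal I) : HasMonomialSupport I := by
  obtain ⟨A, rfl⟩ := hI
  exact hasMonomialSupport_span A

lemma polChain_mem_koszulCycles (hI : IsMonomialIdeal I) (hgen : ∀ a ∈ minGens I, ⇑a ≤ c) {p : ℕ}
    {f : Finset (Fin n) → MvPolynomial (Fin n) K} {b : Fin n →₀ ℕ} (hb : ⇑b ≤ c)
    (h : IsMultihomogeneous f b) (hf : f ∈ koszulCycles X I p) :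
    polChain c f ∈ koszulCycles X (polIdeal c I) p := by
  rw [mem_koszulCycles_iff hasMonomialSupport_polIdeal]
  intro β
  rw [component_polChain hb h]
  split_ifs with hβ
  · subst hβ
    obtain ⟨h1, h2⟩ := (mem_koszulCycles_iff hI.hasMonomialSupport).1 hf b
    refine ⟨polPush_mem_faceChains hgen h1, ?_⟩
    rw [simplexD_polPush hb pos_of_component_ne_zero, h2, map_zero]
  · exact ⟨zero_mem _, map_zero _⟩

lemma pos_of_simplexD_ne_zero {b : Fin n →₀ ℕ} {φ : Finset (Fin n) → K}
    (hφ : ∀ J, φ J ≠ 0 → ∀ i ∈ J, 0 < b i) (J : Finset (Fin n))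
    (hJ : simplexD (Fin n) K φ J ≠ 0) : ∀ i ∈ J, 0 < b i := by
  intro i hi
  rw [simplexD_apply] at hJ
  obtain ⟨j, -, hj⟩ := Finset.exists_ne_zero_of_sum_ne_zero hJ
  exact hφ _ (fun e => hj (by rw [e, smul_zero])) i (Finset.mem_insert_of_mem hi)

/-- If the polarization of a component is a boundary, then so is the component. -/
lemma exists_simplexD_eq_of_polPush (hgen : ∀ a ∈ minGens I, ⇑a ≤ c) {b : Fin n →₀ ℕ}
    (hb : ⇑b ≤ c) {p : ℕ} {φ : Finset (Fin n) → K} (hφ : ∀ J, φ J ≠ 0 → ∀ i ∈ J, 0 < b i)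
    {θ : Finset (PolVar c) → K}
    (hθ : θ ∈ faceChains K (IsKoszulFace (polIdeal c I) (polExp c b)) (p + 1))
    (h : simplexD (PolVar c) K θ = polPush K c b φ) :
    ∃ η ∈ faceChains K (IsKoszulFace I b) (p + 1), simplexD (Fin n) K η = φ := by
  -- The primitive `θ` may use other variables, but its boundary does not, so it can be moved onto
  -- the last variables without changing that boundary.
  obtain ⟨θ', hθ', htop⟩ := exists_sub_simplexD_mem_avoiding hgen hb hθ (by
    rw [h]
    rintro L ⟨v, hv, hv'⟩
    rw [polPush_apply, if_neg fun hL => hv' (hL hv)])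
  obtain ⟨η, hη, he⟩ := exists_polPush_eq hgen hb
    (sub_mem hθ (simplexD_mem_faceChains (fun _ _ h => h.of_insert) hθ')) htop
  have hpos : ∀ J, η J ≠ 0 → ∀ i ∈ J, 0 < b i := fun J hJ => (hη J hJ).2.pos
  refine ⟨η, hη, polPush_injective hb (pos_of_simplexD_ne_zero hpos) hφ ?_⟩
  rw [← simplexD_polPush hb hpos, he, map_sub, koszulD_koszulD, sub_zero, h]

/-- Each cycle in a polarized degree is homologous to the polarization of a cycle. -/
lemma exists_polPush_add_simplexD_eq (hgen : ∀ a ∈ minGens I, ⇑a ≤ c) {b : Fin n →₀ ℕ}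
    (hb : ⇑b ≤ c) {p : ℕ} {ψ : Finset (PolVar c) → K}
    (hψ : ψ ∈ faceChains K (IsKoszulFace (polIdeal c I) (polExp c b)) p)
    (hd : simplexD (PolVar c) K ψ = 0) :
    ∃ φ ∈ faceChains K (IsKoszulFace I b) p, simplexD (Fin n) K φ = 0 ∧
      ∃ θ ∈ faceChains K (IsKoszulFace (polIdeal c I) (polExp c b)) (p + 1),
        polPush K c b φ + simplexD (PolVar c) K θ = ψ := by
  obtain ⟨θ, hθ, htop⟩ := exists_sub_simplexD_mem_avoiding hgen hb hψ
    (by rw [hd]; exact zero_mem _)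
  obtain ⟨φ, hφ, he⟩ := exists_polPush_eq hgen hb
    (sub_mem hψ (simplexD_mem_faceChains (fun _ _ h => h.of_insert) hθ)) htop
  have hpos : ∀ J, φ J ≠ 0 → ∀ i ∈ J, 0 < b i := fun J hJ => (hφ J hJ).2.pos
  refine ⟨φ, hφ, polPush_injective hb (pos_of_simplexD_ne_zero hpos) (by simp) ?_, θ, hθ,
    by rw [he, sub_add_cancel]⟩
  rw [← simplexD_polPush hb hpos, he, map_sub, koszulD_koszulD, hd, sub_zero, map_zero]

/-- Each cycle of the polarized Koszul complex is homologous to an element whose components are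
the polarizations of the components of a cycle. -/
lemma exists_koszulCycle_polPush_add_simplexD_eq (hI : IsMonomialIdeal I)
    (hgen : ∀ a ∈ minGens I, ⇑a ≤ c) {p : ℕ} {w : Finset (PolVar c) → MvPolynomial (PolVar c) K}
    (hw : w ∈ koszulCycles X (polIdeal c I) p) :
    ∃ y ∈ koszulCycles X I p, ∀ b : Fin n →₀ ℕ, ⇑b ≤ c →
      ∃ θ ∈ faceChains K (IsKoszulFace (polIdeal c I) (polExp c b)) (p + 1),
        polPush K c b (component K b y) + simplexD (PolVar c) K θ =
          component K (polExp c b) w := by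
  classical
  have hw' := (mem_koszulCycles_iff hasMonomialSupport_polIdeal).1 hw
  have hex : ∀ b : Fin n →₀ ℕ, ∃ φ ∈ faceChains K (IsKoszulFace I b) p,
      simplexD (Fin n) K φ = 0 ∧ (⇑b ≤ c →
      ∃ θ ∈ faceChains K (IsKoszulFace (polIdeal c I) (polExp c b)) (p + 1),
        polPush K c b φ + simplexD (PolVar c) K θ = component K (polExp c b) w) ∧
      (¬ ⇑b ≤ c → φ = 0) := by
    intro b
    by_cases hb : ⇑b ≤ c
    · obtain ⟨φ, h1, h2, h3⟩ := exists_polPush_add_simplexD_eq hgen hb (hw' _).1 (hw' _).2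
      exact ⟨φ, h1, h2, fun _ => h3, fun h => absurd hb h⟩
    · exact ⟨0, zero_mem _, map_zero _, fun h => absurd h hb, fun _ => rfl⟩
  choose φ h1 h2 h3 h4 using hex
  obtain ⟨y, -, hy⟩ := exists_koszulChain_component_eq hI.hasMonomialSupport φ
    (Finset.Iic (Finsupp.equivFunOnFinite.symm c)) (fun b hb => h4 b fun h => hb (by
      rw [Finset.mem_Iic]; exact h)) h1
  refine ⟨y, (mem_koszulCycles_iff hI.hasMonomialSupport).2 fun b => ?_, fun b hb => ?_⟩
  · rw [hy]; exact ⟨h1 b, h2 b⟩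
  · rw [hy]; exact h3 b hb

end PolarizedChains

end KoszulPol

end

/-! ### The theorem, from the comparison in each degree. -/

theorem theorem1p1 {K : Type*} [Field K] {n : ℕ} (I : Ideal (MvPolynomial (Fin n) K))
    (hI : KoszulPol.IsMonomialIdeal I)
    (c : Fin n → ℕ) (hc : ∀ j, c j = KoszulPol.maxExponent I j) (i r : ℕ)
    (z : Fin r → KoszulPol.koszulCycles (X : Fin n → MvPolynomial (Fin n) K) I i)
    (hz : ∀ k, ∃ b : Fin n → ℕ, b ≤ c ∧ KoszulPol.IsMultihomogeneous (z k).1 b)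
    (hli : LinearIndependent K (fun k => KoszulPol.homologyClass X I i (z k)))
    (hspan : Submodule.span K (Set.range fun k => KoszulPol.homologyClass X I i (z k)) = ⊤) :
    ∃ hcyc : ∀ k, KoszulPol.polChain c (z k).1 ∈
        KoszulPol.koszulCycles (X : KoszulPol.PolVar c → MvPolynomial (KoszulPol.PolVar c) K)
          (KoszulPol.polIdeal c I) i,
      LinearIndependent K (fun k => KoszulPol.homologyClass X (KoszulPol.polIdeal c I) i
        ⟨KoszulPol.polChain c (z k).1, hcyc k⟩) ∧
      Submodule.span K (Set.range fun k => KoszulPol.homologyClass X (KoszulPol.polIdeal c I) i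
        ⟨KoszulPol.polChain c (z k).1, hcyc k⟩) = ⊤ := by
  -- The only property of `c` as a maximum that the argument needs.
  have hgen : ∀ a ∈ KoszulPol.minGens I, ⇑a ≤ c := by
    intro a ha j
    rw [hc j]
    exact Finset.le_sup (f := fun a : Fin n →₀ ℕ => a j)
      ((KoszulPol.minGens_finite I).mem_toFinset.2 ha)
  have hz' : ∀ k, ∃ b : Fin n →₀ ℕ, ⇑b ≤ c ∧ KoszulPol.IsMultihomogeneous (z k).1 b :=
    fun k => let ⟨b, hb⟩ := hz k; ⟨Finsupp.equivFunOnFinite.symm b, hb⟩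
  choose b hb hmul using hz'
  have hcomp : ∀ (g : Fin r → K) (γ : Fin n →₀ ℕ), ⇑γ ≤ c →
      KoszulPol.component K (KoszulPol.polExp c γ)
        (∑ k, g k • KoszulPol.polChain c (z k).1) =
        KoszulPol.polPush K c γ (KoszulPol.component K γ (∑ k, g k • (z k).1)) := by
    intro g γ hγ
    simp only [map_sum, map_smul]
    exact Finset.sum_congr rfl fun k _ => by
      rw [KoszulPol.component_polChain_polExp (hb k) (hmul k) hγ]
  refine ⟨fun k => KoszulPol.polChain_mem_koszulCycles hI hgen (hb k) (hmul k) (z k).2, ?_, ?_⟩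
  · rw [KoszulPol.linearIndependent_homologyClass_iff] at hli ⊢
    intro g hg
    refine hli g ((KoszulPol.mem_koszulBoundaries_iff hI.hasMonomialSupport).2 fun γ => ?_)
    by_cases hγ : ⇑γ ≤ c
    · obtain ⟨θ, hθ, hd⟩ :=
        (KoszulPol.mem_koszulBoundaries_iff KoszulPol.hasMonomialSupport_polIdeal).1 hg
          (KoszulPol.polExp c γ)
      rw [hcomp g γ hγ] at hd
      exact KoszulPol.exists_simplexD_eq_of_polPush hgen hγ KoszulPol.pos_of_component_ne_zero hθ hd
    -- All the `z k` have degrees `≤ c`, so they have no component in degree `γ`.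
    · refine ⟨0, zero_mem _, ?_⟩
      simp only [map_sum, map_smul, map_zero]
      exact (Finset.sum_eq_zero fun k _ => by
        rw [(hmul k).component_eq_zero (by rintro rfl; exact hγ (hb k)), smul_zero]).symm
  · rw [KoszulPol.span_homologyClass_eq_top_iff] at hspan ⊢
    intro w hw
    obtain ⟨y, hy, hyw⟩ := KoszulPol.exists_koszulCycle_polPush_add_simplexD_eq hI hgen hw
    obtain ⟨g, hg⟩ := hspan y hy
    refine ⟨g, (KoszulPol.mem_koszulBoundaries_iff KoszulPol.hasMonomialSupport_polIdeal).2
      fun β => ?_⟩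
    by_cases hβ : ∃ γ : Fin n →₀ ℕ, ⇑γ ≤ c ∧ β = KoszulPol.polExp c γ
    · obtain ⟨γ, hγ, rfl⟩ := hβ
      obtain ⟨θ, hθ, hd⟩ := hyw γ hγ
      obtain ⟨η, hη, hdη⟩ :=
        (KoszulPol.mem_koszulBoundaries_iff hI.hasMonomialSupport).1 hg γ
      -- In this degree `w` differs from the transfer of `y` by `∂θ`, and `y` differs from the
      -- combination of the `z k` by `∂η`.
      refine ⟨θ + KoszulPol.polPush K c γ η,
        add_mem hθ (KoszulPol.polPush_mem_faceChains hgen hη), ?_⟩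
      rw [map_add, KoszulPol.simplexD_polPush hγ fun J hJ => (hη J hJ).2.pos, hdη, map_sub,
        map_sub, map_sub, hcomp g γ hγ, ← hd]
      abel
    · push Not at hβ
      have hsub : w - ∑ k, g k • KoszulPol.polChain c (z k).1 ∈
          KoszulPol.koszulCycles X (KoszulPol.polIdeal c I) i :=
        sub_mem hw (sum_mem fun k _ => Submodule.smul_of_tower_mem _ _
          (KoszulPol.polChain_mem_koszulCycles hI hgen (hb k) (hmul k) (z k).2))
      obtain ⟨h1, h2⟩ :=
        (KoszulPol.mem_koszulCycles_iff KoszulPol.hasMonomialSupport_polIdeal).1 hsub β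
      exact KoszulPol.exists_simplexD_eq_of_ne_polExp hβ h1 h2
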